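/- Let $G$ be a finite group and let $\mathrm{Irr}(G)$ be the set of its irreducible complex characters. For $\chi\in\mathrm{Irr}(G)$ let $\mathbb{Q}(\chi)=\mathbb{Q}(\chi(g) : g\in G)$, and for $x\in G$ let $\mathbb{Q}(x)=\mathbb{Q}(\psi(x) : \psi\in\mathrm{Irr}(G))$, which depends only on the conjugacy class of $x$. An irreducible character $\chi$ is called irrational if $\mathbb{Q}(\chi)\neq\mathbb{Q}$, and the conjugacy class of $x$ is called irrational if $\mathbb{Q}(x)\neq\mathbb{Q}$. Theorem. There is a function $f:\mathbb{N}\to\mathbb{N}$ such that for every integer $n\ge 0$ and every finite group $G$ the following hold. (1) If $G$ has exactly $n$ irrational conjugacy classes, then $G$ has at most $f(n)$ irrational irreducible characters, and $[\mathbb{Q}(\chi):\mathbb{Q}]\le f(n)$ for every $\chi\in\mathrm{Irr}(G)$. (2) If $G$ has exactly $n$ irrational irreducible characters, then $G$ has at most $f(n)$ irrational conjugacy classes, and $[\mathbb{Q}(x):\mathbb{Q}]\le f(n)$ for every $x\in G$. -/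

import Mathlib

namespace FewIrrational

variable (G : Type*) [Group G]

/-- The set `Irr(G)` of irreducible complex characters of `G`, as functions `G → ℂ`. Every
finite-dimensional complex representation is isomorphic to one on some `ℂ ^ d`, and the irreducible
representations of a finite group are finite-dimensional. -/
def Irr : Set (G → ℂ) :=
  {χ | ∃ (d : ℕ) (ρ : Representation ℂ G (Fin d → ℂ)), ρ.IsIrreducible ∧ ρ.character = χ}

variable {G}

/-- The field `ℚ(χ)` generated over `ℚ` by the values `χ(g)`, `g ∈ G`. -/
noncomputable def charField (χ : G → ℂ) : IntermediateField ℚ ℂ :=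
  IntermediateField.adjoin ℚ {z | ∃ g : G, z = χ g}

/-- The field `ℚ(x)` generated over `ℚ` by the values `ψ(x)`, `ψ ∈ Irr(G)`. -/
noncomputable def elementField (x : G) : IntermediateField ℚ ℂ :=
  IntermediateField.adjoin ℚ {z | ∃ ψ ∈ Irr G, z = ψ x}

variable (G)

/-- The set of irrational irreducible characters: those with `ℚ(χ) ≠ ℚ`. -/
def irrationalChars : Set (G → ℂ) :=
  {χ | χ ∈ Irr G ∧ charField χ ≠ ⊥}

/-- The set of irrational conjugacy classes: the classes of the elements `x` with `ℚ(x) ≠ ℚ`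
(a condition that depends only on the class of `x`, as characters are class functions). -/
def irrationalClasses : Set (ConjClasses G) :=
  {K | ∃ x : G, ConjClasses.mk x = K ∧ elementField x ≠ ⊥}

end FewIrrational

namespace FewIrrational

/-! Automorphisms of `ℂ` permute the rows of the character table, by conjugating matrix entries, and
its columns, because each sends a root of unity `ζ` to some `ζ ^ k` and so turns `χ g` into `χ (g ^
k)`. The rows form a basis of the class functions, so Brauer's permutation lemma shows that each
automorphism moves as many rows as columns.

Suppose `n` columns are irrational. An automorphism acts on all table entries through its self-map
of these columns, so at most `n ^ n` actions occur. This bounds the degrees of the row fields, since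
every embedding of such a field in `ℂ` extends to an automorphism of `ℂ`. Each action moves at most
`n` columns, hence at most `n` rows, and every irrational row is moved by one of them. This is
`rows_bounded_of_columns`; it treats rows and columns alike, so the transposed table gives the other
half. -/

/-! ### Automorphisms of `ℂ` and number fields -/

/-- Both fields are algebraic closures of polynomial rings over `K` in equinumerous variables. -/
theorem exists_ringEquiv_of_transcendenceBasis {K L M ι κ : Type*} [Field K] [Field L] [Field M]
    [Algebra K L] [Algebra K M] [IsAlgClosed L] [IsAlgClosed M] (e : ι ≃ κ) {v : ι → L} {w : κ → M}
    (hv : IsTranscendenceBasis K v) (hw : IsTranscendenceBasis K w) :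
    ∃ σ : L ≃+* M, ∀ x, σ (algebraMap K L x) = algebraMap K M x := by
  have := IsAlgClosed.isAlgClosure_of_transcendence_basis v hv
  have := IsAlgClosed.isAlgClosure_of_transcendence_basis w hw
  let φ : Algebra.adjoin K (Set.range v) ≃ₐ[K] Algebra.adjoin K (Set.range w) :=
    (hv.1.aevalEquiv.symm.trans (MvPolynomial.renameEquiv K e)).trans hw.1.aevalEquiv
  refine ⟨IsAlgClosure.equivOfEquiv L M φ.toRingEquiv, fun x => ?_⟩
  have h := IsAlgClosure.equivOfEquiv_algebraMap L M φ.toRingEquiv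
    (algebraMap K (Algebra.adjoin K (Set.range v)) x)
  have h2 : φ.toRingEquiv (algebraMap K (Algebra.adjoin K (Set.range v)) x) =
    algebraMap K (Algebra.adjoin K (Set.range w)) x := φ.commutes x
  rw [h2] at h
  exact h

/-- Any two embeddings of an algebraic extension of `ℚ` into `ℂ` differ by an automorphism
of `ℂ`. -/
theorem exists_ringEquiv_extending {K : Type} [Field K] [Algebra ℚ K] [Algebra.IsAlgebraic ℚ K]
    (f g : K →+* ℂ) : ∃ σ : ℂ ≃+* ℂ, ∀ x, σ (f x) = g x := by
  -- `K` is algebraic over `ℚ`, so the transcendence degree of `ℂ` over `K` does not depend on the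
  -- embedding.
  have key : ∀ f : K →+* ℂ, letI := f.toAlgebra; Algebra.trdeg K ℂ = Algebra.trdeg ℚ ℂ := by
    intro f
    let _ := f.toAlgebra
    have : IsScalarTower ℚ K ℂ := IsScalarTower.of_algebraMap_eq' (Subsingleton.elim _ _)
    have h := _root_.trdeg_add_eq ℚ K (A := ℂ)
    rwa [trdeg_eq_zero, zero_add] at h
  obtain ⟨s, hs⟩ := (by
    let _ := f.toAlgebra
    exact exists_isTranscendenceBasis K ℂ :
      ∃ s : Set ℂ, @IsTranscendenceBasis s K ℂ _ _ f.toAlgebra Subtype.val)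
  obtain ⟨t, ht⟩ := (by
    let _ := g.toAlgebra
    exact exists_isTranscendenceBasis K ℂ :
      ∃ s : Set ℂ, @IsTranscendenceBasis s K ℂ _ _ g.toAlgebra Subtype.val)
  have hst : Cardinal.mk s = Cardinal.mk t := by
    have h1 := @IsTranscendenceBasis.cardinalMk_eq_trdeg K ℂ _ _ f.toAlgebra _ _ _ _ hs
    have h2 := @IsTranscendenceBasis.cardinalMk_eq_trdeg K ℂ _ _ g.toAlgebra _ _ _ _ ht
    rw [h1, h2, key f, key g]
  obtain ⟨e⟩ := Cardinal.eq.1 hst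
  exact @exists_ringEquiv_of_transcendenceBasis K ℂ ℂ s t _ _ _ f.toAlgebra g.toAlgebra
    _ _ e _ _ hs ht

/-- If the restriction to `S` of an automorphism of `ℂ` is determined by an invariant with values
in a finite type `T`, then `ℚ(S)` has degree at most `|T|`. -/
theorem rank_adjoin_le {S : Set ℂ} (hS : S.Finite) (halg : ∀ z ∈ S, IsAlgebraic ℚ z)
    {T : Type*} [Finite T] (q : (ℂ ≃+* ℂ) → T)
    (hq : ∀ σ τ, q σ = q τ → ∀ z ∈ S, σ z = τ z) :
    FiniteDimensional ℚ (IntermediateField.adjoin ℚ S) ∧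
      Module.finrank ℚ (IntermediateField.adjoin ℚ S) ≤ Nat.card T := by
  have := hS.to_subtype
  have : FiniteDimensional ℚ (IntermediateField.adjoin ℚ S) :=
    IntermediateField.finiteDimensional_adjoin fun z hz => (halg z hz).isIntegral
  refine ⟨this, ?_⟩
  -- The degree is the number of embeddings into `ℂ`; `q` separates their extensions to `ℂ`.
  rw [← AlgHom.card ℚ (IntermediateField.adjoin ℚ S) ℂ, Fintype.card_eq_nat_card]
  have hext := fun φ : IntermediateField.adjoin ℚ S →ₐ[ℚ] ℂ =>
    exists_ringEquiv_extending (IntermediateField.adjoin ℚ S).val.toRingHom φ.toRingHom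
  choose E hE using hext
  refine Nat.card_le_card_of_injective (fun φ => q (E φ)) fun φ ψ h => ?_
  refine IntermediateField.algHom_ext_of_eq_adjoin _ rfl fun z hz => ?_
  have h1 := hE φ ⟨z, IntermediateField.subset_adjoin ℚ S hz⟩
  have h2 := hE ψ ⟨z, IntermediateField.subset_adjoin ℚ S hz⟩
  exact h1.symm.trans ((hq _ _ h z hz).trans h2)

theorem adjoin_ne_bot_iff {S : Set ℂ} (hS : S.Finite) (halg : ∀ z ∈ S, IsAlgebraic ℚ z) :
    IntermediateField.adjoin ℚ S ≠ ⊥ ↔ ∃ σ : ℂ ≃+* ℂ, ∃ z ∈ S, σ z ≠ z := by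
  constructor
  · contrapose!
    intro h
    obtain ⟨h1, h2⟩ := rank_adjoin_le hS halg (T := Unit) (fun _ => ()) fun σ τ _ z hz => by
      rw [h σ z hz, h τ z hz]
    rw [← IntermediateField.finrank_eq_one_iff]
    have := Module.finrank_pos (R := ℚ) (M := IntermediateField.adjoin ℚ S)
    simp only [Nat.card_unique] at h2
    omega
  · rintro ⟨σ, z, hz, hne⟩ h
    have hz' := IntermediateField.subset_adjoin ℚ S hz
    rw [h] at hz'
    obtain ⟨r, rfl⟩ := IntermediateField.mem_bot.1 hz'
    exact hne (by simp)

/-! ### Counting irrational rows -/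

/-- Let `X` be a finite matrix of algebraic numbers, with distinct columns, on which every
automorphism of `ℂ` acts by permuting columns and moves as many rows as columns. Then the number
of irrational columns bounds the number of irrational rows and the degrees of the row fields. -/
theorem rows_bounded_of_columns {I C : Type*} [Finite I] [Finite C] (X : I → C → ℂ)
    (halg : ∀ i c, IsAlgebraic ℚ (X i c))
    (hgal : ∀ (σ : ℂ ≃+* ℂ) c, ∃ c', ∀ i, σ (X i c) = X i c')
    (hmoved : ∀ σ : ℂ ≃+* ℂ, {i | ∃ c, σ (X i c) ≠ X i c}.ncard =
      {c | ∃ i, σ (X i c) ≠ X i c}.ncard)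
    {n : ℕ} (hn : {c | IntermediateField.adjoin ℚ (Set.range fun i => X i c) ≠ ⊥}.ncard = n) :
    {i | IntermediateField.adjoin ℚ (Set.range (X i)) ≠ ⊥}.ncard ≤ (n + 1) * n ^ n ∧
    ∀ i, Module.rank ℚ (IntermediateField.adjoin ℚ (Set.range (X i))) ≤
      (((n + 1) * n ^ n : ℕ) : Cardinal) := by
  have hrow : ∀ i, IntermediateField.adjoin ℚ (Set.range (X i)) ≠ ⊥ ↔
      ∃ σ : ℂ ≃+* ℂ, ∃ c, σ (X i c) ≠ X i c := fun i => by
    rw [adjoin_ne_bot_iff (Set.finite_range _) (by rintro _ ⟨c, rfl⟩; exact halg i c)]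
    simp
  have hcol : ∀ c, IntermediateField.adjoin ℚ (Set.range fun i => X i c) ≠ ⊥ ↔
      ∃ σ : ℂ ≃+* ℂ, ∃ i, σ (X i c) ≠ X i c := fun c => by
    rw [adjoin_ne_bot_iff (Set.finite_range _) (by rintro _ ⟨i, rfl⟩; exact halg i c)]
    simp
  simp only [hrow]
  simp only [hcol] at hn
  set U : Set C := {c | ∃ σ : ℂ ≃+* ℂ, ∃ i, σ (X i c) ≠ X i c} with hU
  choose q hq using hgal
  have hqU : ∀ σ, ∀ c : U, q σ c ∈ U := by
    rintro σ ⟨c, τ, i, h⟩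
    -- If `τ` moves column `c`, its conjugate by `σ` moves column `q σ c`.
    refine ⟨(σ.symm.trans τ).trans σ, i, ?_⟩
    simpa [← hq] using h
  let Q : (ℂ ≃+* ℂ) → (U → U) := fun σ c => ⟨q σ c, hqU σ c⟩
  have hQ : ∀ σ τ, Q σ = Q τ → ∀ i c, σ (X i c) = τ (X i c) := by
    intro σ τ h i c
    by_cases hc : c ∈ U
    · have := congrArg Subtype.val (congrFun h ⟨c, hc⟩)
      simp only [Q] at this
      rw [hq, hq, this]
    · have : ∀ σ : ℂ ≃+* ℂ, σ (X i c) = X i c := by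
        intro σ
        by_contra hσ
        exact hc ⟨σ, i, hσ⟩
      rw [this, this]
  have hcardT : Nat.card (U → U) = n ^ n := by
    rw [Nat.card_fun, Nat.card_coe_set_eq, hn]
  constructor
  -- One automorphism per value of `Q` suffices to detect every irrational row.
  · have hsub : {i | ∃ σ : ℂ ≃+* ℂ, ∃ c, σ (X i c) ≠ X i c} =
        ⋃ t : Set.range Q, {i | ∃ c, t.2.choose (X i c) ≠ X i c} := by
      ext i
      simp only [Set.mem_ofPred_eq, Set.mem_iUnion]
      constructor
      · rintro ⟨σ, c, h⟩
        refine ⟨⟨Q σ, σ, rfl⟩, c, ?_⟩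
        have hs : Q (Exists.choose (⟨σ, rfl⟩ : Q σ ∈ Set.range Q)) = Q σ :=
          Exists.choose_spec (⟨σ, rfl⟩ : Q σ ∈ Set.range Q)
        rw [hQ _ _ hs]
        exact h
      · rintro ⟨t, c, h⟩
        exact ⟨_, c, h⟩
    rw [hsub]
    have := Fintype.ofFinite (Set.range Q)
    calc _ ≤ ∑ t : Set.range Q, {i | ∃ c, t.2.choose (X i c) ≠ X i c}.ncard := by
          exact Set.ncard_iUnion_le_of_fintype _
      _ ≤ ∑ t : Set.range Q, n := by
          refine Finset.sum_le_sum fun t _ => ?_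
          rw [hmoved, ← hn]
          exact Set.ncard_le_ncard (fun c ⟨i, h⟩ => ⟨_, i, h⟩) (Set.toFinite _)
      _ = Nat.card (Set.range Q) * n := by simp
      _ ≤ n ^ n * n := by
          refine Nat.mul_le_mul_right _ ?_
          rw [← hcardT]
          exact Nat.card_le_card_of_injective _ Subtype.val_injective
      -- The factor `n + 1` replaces `n` so that the same bound is at least `1` when `n = 0`, as
      -- degrees require.
      _ ≤ (n + 1) * n ^ n := by
          rw [mul_comm]
          exact Nat.mul_le_mul_right _ (Nat.le_succ n)
  · intro i
    obtain ⟨h1, h2⟩ := rank_adjoin_le (Set.finite_range (X i))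
      (by rintro _ ⟨c, rfl⟩; exact halg i c) Q
      (by rintro σ τ h _ ⟨c, rfl⟩; exact hQ σ τ h i c)
    rw [← Module.finrank_eq_rank, Nat.cast_le]
    rw [hcardT] at h2
    exact h2.trans (Nat.le_mul_of_pos_left _ (Nat.succ_pos n))

/-! ### Brauer's permutation lemma -/

/-- **Brauer's permutation lemma**: if the rows of `X` form a basis of the space of functions on
`C`, then a transformation of the rows that agrees with one of the columns has as many fixed
points. -/
theorem card_fixed_eq {I C : Type*} [Fintype I] [Fintype C] [DecidableEq I] [DecidableEq C]
    (B : Module.Basis I ℂ (C → ℂ)) (p : I → I) (q : C → C) (h : ∀ i c, B (p i) c = B i (q c)) :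
    Fintype.card {i // p i = i} = Fintype.card {c // q c = c} := by
  -- The trace of `f ↦ f ∘ q` counts fixed points of `p` in the basis `B` and fixed points of `q` in
  -- the standard basis.
  have h1 := LinearMap.trace_eq_matrix_trace ℂ B (LinearMap.funLeft ℂ ℂ q)
  have h2 := LinearMap.trace_eq_matrix_trace ℂ (Pi.basisFun ℂ C) (LinearMap.funLeft ℂ ℂ q)
  have hB : ∀ i, LinearMap.funLeft ℂ ℂ q (B i) = B (p i) := fun i => by
    ext c; rw [h]; rfl
  have e1 : Matrix.trace (LinearMap.toMatrix B B (LinearMap.funLeft ℂ ℂ q)) =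
      Fintype.card {i // p i = i} := by
    simp [Matrix.trace, LinearMap.toMatrix_apply, hB, Finsupp.single_apply, Fintype.card_subtype]
  have e2 : Matrix.trace (LinearMap.toMatrix (Pi.basisFun ℂ C) (Pi.basisFun ℂ C)
      (LinearMap.funLeft ℂ ℂ q)) = Fintype.card {c // q c = c} := by
    simp [Matrix.trace, LinearMap.funLeft_apply, Pi.single_apply, Fintype.card_subtype]
  have : (Fintype.card {i // p i = i} : ℂ) = Fintype.card {c // q c = c} := by
    rw [← e1, ← e2, ← h1, h2]
  exact_mod_cast this

theorem moved_rows_eq_moved_columns {I C : Type*} [Finite I] [Finite C]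
    (B : Module.Basis I ℂ (C → ℂ)) (σ : ℂ ≃+* ℂ)
    (hrow : ∀ i, ∃ i', ∀ c, σ (B i c) = B i' c) (hcol : ∀ c, ∃ c', ∀ i, σ (B i c) = B i c') :
    {i | ∃ c, σ (B i c) ≠ B i c}.ncard = {c | ∃ i, σ (B i c) ≠ B i c}.ncard := by
  classical
  have := Fintype.ofFinite I
  have := Fintype.ofFinite C
  choose p hp using hrow
  choose q hq using hcol
  -- Evaluations at `c` and `c'` that agree on a basis agree everywhere.
  have hcolinj : ∀ c c', (∀ i, B i c = B i c') → c = c' := by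
    intro c c' h
    have : LinearMap.proj (R := ℂ) (φ := fun _ : C => ℂ) c = LinearMap.proj c' := B.ext h
    by_contra hne
    have := LinearMap.congr_fun this (Pi.single c 1)
    simp [Ne.symm hne] at this
  have hfix := card_fixed_eq B p q fun i c => by rw [← hp, hq]
  have hIC : Fintype.card I = Fintype.card C := by
    rw [← Module.finrank_eq_card_basis B, Module.finrank_fintype_fun_eq_card]
  have e1 : {i | ∃ c, σ (B i c) ≠ B i c} = {i | p i = i}ᶜ := by
    ext i
    simp only [Set.mem_ofPred_eq, Set.mem_compl_iff, ← not_forall, hp]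
    refine not_congr ⟨fun h => B.injective (funext h), fun h c => by rw [h]⟩
  have e2 : {c | ∃ i, σ (B i c) ≠ B i c} = {c | q c = c}ᶜ := by
    ext c
    simp only [Set.mem_ofPred_eq, Set.mem_compl_iff, ← not_forall, hq]
    refine not_congr ⟨fun h => hcolinj _ _ h, fun h i => by rw [h]⟩
  rw [e1, e2, Set.ncard_compl, Set.ncard_compl, Nat.card_eq_fintype_card,
    Nat.card_eq_fintype_card, hIC, ← Nat.card_coe_set_eq, ← Nat.card_coe_set_eq]
  congr 1
  rw [Nat.card_eq_fintype_card, Nat.card_eq_fintype_card]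
  exact hfix

/-! ### Galois conjugates of representations -/

/-- The preimage of a subrepresentation under a semilinear equivariant bijection is again a
subrepresentation. -/
theorem isIrreducible_of_semilinear {G k V W : Type*} [Group G] [Field k] [AddCommGroup V]
    [Module k V] [AddCommGroup W] [Module k W] (σ : k ≃+* k) (e : V ≃+ W)
    (he : ∀ a v, e (a • v) = σ a • e v) (ρ : Representation k G V) (τ : Representation k G W)
    (h : ∀ g v, τ g (e v) = e (ρ g v)) (hρ : ρ.IsIrreducible) : τ.IsIrreducible := by
  have hnt : Nontrivial V := by
    by_contra hV
    rw [not_nontrivial_iff_subsingleton] at hV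
    obtain ⟨p, q, hpq⟩ := hρ.toNontrivial
    exact hpq (SetLike.ext fun v => by
      rw [Subsingleton.elim v 0]
      exact iff_of_true p.toSubmodule.zero_mem q.toSubmodule.zero_mem)
  obtain ⟨v, hv⟩ := exists_ne (0 : V)
  refine { exists_pair_ne := ⟨⊥, ⊤, fun hbt => ?_⟩, eq_bot_or_eq_top := fun p => ?_ }
  · have h1 : e v ∈ (⊥ : Subrepresentation τ) := by
      rw [hbt]
      exact Submodule.mem_top (R := k)
    exact hv (by simpa using (Submodule.mem_bot k).1 h1)
  · let q : Subrepresentation ρ :=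
      { toSubmodule :=
          { carrier := {v | e v ∈ p.toSubmodule}
            add_mem' := fun {a b} ha hb => by
              simpa using p.toSubmodule.add_mem ha hb
            zero_mem' := by simp
            smul_mem' := fun a v hv => by
              simpa [he] using p.toSubmodule.smul_mem (σ a) hv }
        apply_mem_toSubmodule := fun g v hv => by
          have := p.apply_mem_toSubmodule g hv
          rwa [h] at this }
    rcases hρ.eq_bot_or_eq_top q with hq | hq
    · left
      refine SetLike.ext fun w => ⟨fun hw => ?_, fun hw => ?_⟩
      · have h1 : e.symm w ∈ q := by
          change e (e.symm w) ∈ p.toSubmodule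
          rw [e.apply_symm_apply]
          exact hw
        rw [hq] at h1
        have h2 : e.symm w = 0 := (Submodule.mem_bot k).1 h1
        rw [(by simpa using h2 : w = 0)]
        exact (⊥ : Subrepresentation τ).toSubmodule.zero_mem
      · have h2 : w = 0 := (Submodule.mem_bot k).1 hw
        rw [h2]
        exact p.toSubmodule.zero_mem
    · right
      refine SetLike.ext fun w => ⟨fun _ => Submodule.mem_top (R := k), fun _ => ?_⟩
      have h1 : e.symm w ∈ q := by
        rw [hq]
        exact Submodule.mem_top (R := k)
      have h2 : e (e.symm w) ∈ p.toSubmodule := h1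
      rwa [e.apply_symm_apply] at h2

/-- Applying a field automorphism of `ℂ` to the character of an irreducible representation gives
an irreducible character. -/
theorem galois_character_mem_Irr {G V : Type*} [Group G] [AddCommGroup V] [Module ℂ V]
    [FiniteDimensional ℂ V] (σ : ℂ ≃+* ℂ) (ρ : Representation ℂ G V) (hρ : ρ.IsIrreducible) :
    (fun g => σ (ρ.character g)) ∈ Irr G := by
  classical
  let b := Module.finBasis ℂ V
  let φ : Module.End ℂ V →* Module.End ℂ (Fin (Module.finrank ℂ V) → ℂ) :=
    ((Matrix.toLinAlgEquiv' (R := ℂ)).toRingEquiv.toRingHom.comp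
      ((σ : ℂ →+* ℂ).mapMatrix.comp
        (LinearMap.toMatrixAlgEquiv b).toRingEquiv.toRingHom)).toMonoidHom
  have hφ : ∀ T, φ T = Matrix.toLin' ((LinearMap.toMatrix b b T).map σ) := fun T => rfl
  let e : V ≃+ (Fin (Module.finrank ℂ V) → ℂ) :=
    b.equivFun.toAddEquiv.trans (AddEquiv.piCongrRight fun _ => σ.toAddEquiv)
  have he : ∀ v i, e v i = σ (b.repr v i) := fun v i => rfl
  refine ⟨_, φ.comp ρ, isIrreducible_of_semilinear σ e ?_ ρ _ ?_ hρ, ?_⟩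
  · intro a v
    ext i
    simp [he]
  · intro g v
    ext i
    rw [MonoidHom.comp_apply, hφ, he, ← LinearMap.toMatrix_mulVec_repr b b (ρ g) v,
      Matrix.toLin'_apply]
    simp only [Matrix.mulVec, dotProduct, Matrix.map_apply, map_sum, map_mul, he]
  · ext g
    simp only [Representation.character, MonoidHom.comp_apply, hφ, Matrix.trace_toLin'_eq]
    rw [LinearMap.trace_eq_matrix_trace ℂ b]
    simp [Matrix.trace]

theorem character_mem_Irr {G V : Type*} [Group G] [AddCommGroup V] [Module ℂ V]
    [FiniteDimensional ℂ V] (ρ : Representation ℂ G V) (hρ : ρ.IsIrreducible) :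
    ρ.character ∈ Irr G :=
  galois_character_mem_Irr (RingEquiv.refl ℂ) ρ hρ

/-! ### Character values as sums of roots of unity -/

/-- For `x = ζ⁻¹ ^ j • T` this average is the projection onto the `ζ ^ j`-eigenspace of `T`. -/
theorem isIdempotentElem_average {A : Type*} [Ring A] [Algebra ℂ A] {x : A} {N : ℕ}
    (hN : N ≠ 0) (hx : x ^ N = 1) :
    x * ((N : ℂ)⁻¹ • ∑ m ∈ Finset.range N, x ^ m) = (N : ℂ)⁻¹ • ∑ m ∈ Finset.range N, x ^ m ∧
    IsIdempotentElem ((N : ℂ)⁻¹ • ∑ m ∈ Finset.range N, x ^ m) := by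
  have h1 : x * ((N : ℂ)⁻¹ • ∑ m ∈ Finset.range N, x ^ m) =
      (N : ℂ)⁻¹ • ∑ m ∈ Finset.range N, x ^ m := by
    have h := mul_geom_sum x N
    rw [hx, sub_self, sub_mul, one_mul, sub_eq_zero] at h
    rw [mul_smul_comm, h]
  refine ⟨h1, ?_⟩
  set e := (N : ℂ)⁻¹ • ∑ m ∈ Finset.range N, x ^ m with he
  have h2 : ∀ m : ℕ, x ^ m * e = e := by
    intro m
    induction m with
    | zero => simp
    | succ m ih => rw [pow_succ, mul_assoc, h1, ih]
  have h3 : e * e = (N : ℂ)⁻¹ • ∑ m ∈ Finset.range N, x ^ m * e := by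
    conv_lhs => lhs; rw [he]
    rw [smul_mul_assoc, Finset.sum_mul]
  rw [IsIdempotentElem, h3]
  simp only [h2, Finset.sum_const, Finset.card_range]
  rw [← Nat.cast_smul_eq_nsmul ℂ, smul_smul, inv_mul_cancel₀ (by exact_mod_cast hN), one_smul]

/-- The traces of the powers of an endomorphism `T` with `T ^ N = 1`, in terms of the
multiplicities `a j` of the eigenvalues `ζ ^ j`. -/
theorem exists_trace_pow_eq {V : Type*} [AddCommGroup V] [Module ℂ V] [FiniteDimensional ℂ V]
    {N : ℕ} (hN : N ≠ 0) {ζ : ℂ} (hζ : IsPrimitiveRoot ζ N) {T : Module.End ℂ V}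
    (hT : T ^ N = 1) :
    ∃ a : ℕ → ℕ, ∀ k, LinearMap.trace ℂ V (T ^ k) =
      ∑ j ∈ Finset.range N, (ζ ^ j) ^ k * (a j : ℂ) := by
  have hζ0 : ζ ≠ 0 := hζ.ne_zero hN
  let x : ℕ → Module.End ℂ V := fun j => (ζ⁻¹ ^ j) • T
  have hx : ∀ j, x j ^ N = 1 := fun j => by
    rw [smul_pow, hT, ← pow_mul, mul_comm j N, pow_mul, inv_pow, hζ.pow_eq_one]
    simp
  let e : ℕ → Module.End ℂ V := fun j => (N : ℂ)⁻¹ • ∑ m ∈ Finset.range N, x j ^ m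
  have he1 : ∀ j, T * e j = ζ ^ j • e j := fun j => by
    have h := (isIdempotentElem_average hN (hx j)).1
    calc T * e j = ζ ^ j • (x j * e j) := by
          simp only [x]
          rw [smul_mul_assoc, smul_smul, inv_pow, mul_inv_cancel₀ (pow_ne_zero _ hζ0), one_smul]
      _ = ζ ^ j • e j := by rw [h]
  have he2 : ∀ k j, T ^ k * e j = (ζ ^ j) ^ k • e j := by
    intro k j
    induction k with
    | zero => simp
    | succ k ih => rw [pow_succ, mul_assoc, he1, mul_smul_comm, ih, smul_smul, pow_succ, mul_comm]
  have hsum : ∑ j ∈ Finset.range N, e j = 1 := by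
    have hη : IsPrimitiveRoot ζ⁻¹ N := hζ.inv
    simp only [e, x, smul_pow]
    rw [← Finset.smul_sum, Finset.sum_comm]
    simp only [← Finset.sum_smul]
    rw [Finset.sum_eq_single_of_mem 0 (Finset.mem_range.2 (Nat.pos_of_ne_zero hN))]
    · simp [smul_smul, hN]
    · intro m hm hm0
      have h1 : ∑ j ∈ Finset.range N, (ζ⁻¹ ^ j) ^ m = 0 := by
        have hne : ζ⁻¹ ^ m ≠ 1 := hη.pow_ne_one_of_pos_of_lt hm0 (Finset.mem_range.1 hm)
        have h := mul_geom_sum (ζ⁻¹ ^ m) N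
        rw [← pow_mul, mul_comm m N, pow_mul, hη.pow_eq_one, one_pow, sub_self] at h
        have h' := (mul_eq_zero.1 h).resolve_left (sub_ne_zero.2 hne)
        rw [← h']
        refine Finset.sum_congr rfl fun j _ => ?_
        rw [← pow_mul, ← pow_mul, mul_comm]
      rw [h1, zero_smul]
  -- The trace of an idempotent is its rank.
  have htr : ∀ j, ∃ a : ℕ, LinearMap.trace ℂ V (e j) = a := fun j =>
    ⟨_, (LinearMap.IsIdempotentElem.isProj_range (e j)
      (isIdempotentElem_average hN (hx j)).2).trace⟩
  choose a ha using htr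
  refine ⟨a, fun k => ?_⟩
  calc LinearMap.trace ℂ V (T ^ k) = LinearMap.trace ℂ V (T ^ k * ∑ j ∈ Finset.range N, e j) := by
        rw [hsum, mul_one]
    _ = _ := by simp [Finset.mul_sum, he2, ha]

theorem isAlgebraic_of_mem_Irr {G : Type*} [Group G] [Finite G] {χ : G → ℂ} (hχ : χ ∈ Irr G)
    (g : G) : IsAlgebraic ℚ (χ g) := by
  obtain ⟨d, ρ, -, rfl⟩ := hχ
  have hN : Nat.card G ≠ 0 := Nat.card_pos.ne'
  have hζ := Complex.isPrimitiveRoot_exp (Nat.card G) hN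
  obtain ⟨a, ha⟩ := exists_trace_pow_eq hN hζ (T := ρ g) (by rw [← map_pow, pow_card_eq_one', map_one])
  have h := ha 1
  rw [pow_one] at h
  rw [Representation.character, h]
  refine IsIntegral.isAlgebraic (IsIntegral.sum _ fun j _ => ?_)
  refine IsIntegral.mul ((IsIntegral.pow ?_ _).pow _) ?_
  · exact (hζ.isIntegral (Nat.pos_of_ne_zero hN)).tower_top
  · simpa using isIntegral_algebraMap (R := ℚ) (A := ℂ) (x := (a j : ℚ))

/-- An automorphism of `ℂ` acts on the values of the irreducible characters at `g` by passing
to a power of `g`. -/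
theorem exists_galois_eq_pow {G : Type*} [Group G] [Finite G] (σ : ℂ ≃+* ℂ) (g : G) :
    ∃ h : G, ∀ χ ∈ Irr G, σ (χ g) = χ h := by
  have hN : Nat.card G ≠ 0 := Nat.card_pos.ne'
  have hζ := Complex.isPrimitiveRoot_exp (Nat.card G) hN
  set ζ := Complex.exp (2 * Real.pi * Complex.I / (Nat.card G : ℕ))
  have : NeZero (Nat.card G) := ⟨hN⟩
  -- The exponent `k` depends on `σ` alone, so one power of `g` serves all characters.
  obtain ⟨k, -, hk⟩ := hζ.eq_pow_of_pow_eq_one (ξ := σ ζ)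
    (by rw [← map_pow, hζ.pow_eq_one, map_one])
  refine ⟨g ^ k, ?_⟩
  rintro χ ⟨d, ρ, -, rfl⟩
  obtain ⟨a, ha⟩ := exists_trace_pow_eq hN hζ (T := ρ g)
    (by rw [← map_pow, pow_card_eq_one', map_one])
  have h := ha 1
  rw [pow_one] at h
  rw [Representation.character, Representation.character, h, map_pow, ha, map_sum]
  refine Finset.sum_congr rfl fun j _ => ?_
  rw [map_mul, map_natCast, pow_one, map_pow, ← hk, ← pow_mul, ← pow_mul, mul_comm k j]

theorem galois_mem_Irr {G : Type*} [Group G] (σ : ℂ ≃+* ℂ) {χ : G → ℂ} (hχ : χ ∈ Irr G) :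
    (fun g => σ (χ g)) ∈ Irr G := by
  obtain ⟨d, ρ, hρ, rfl⟩ := hχ
  exact galois_character_mem_Irr σ ρ hρ

theorem Irr_conj {G : Type*} [Group G] {χ : G → ℂ} (hχ : χ ∈ Irr G) {g h : G}
    (hgh : IsConj g h) : χ g = χ h := by
  obtain ⟨d, ρ, -, rfl⟩ := hχ
  obtain ⟨c, rfl⟩ := isConj_iff.1 hgh
  rw [Representation.char_conj]

/-! ### Irreducible characters span the class functions -/

theorem linearIndependent_Irr (G : Type*) [Group G] [Finite G] :
    LinearIndependent ℂ (fun χ : Irr G => (χ : G → ℂ)) := by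
  classical
  have := Fintype.ofFinite G
  have : Invertible (Nat.card G : ℂ) :=
    invertibleOfNonzero (by exact_mod_cast Nat.card_pos.ne')
  have horth : ∀ χ ψ : Irr G, (Nat.card G : ℂ)⁻¹ * ∑ g : G, χ.1 g * ψ.1 g⁻¹ =
      if χ = ψ then 1 else 0 := by
    rintro ⟨χ, d, ρ, hρ, rfl⟩ ⟨ψ, d', τ, hτ, rfl⟩
    have h := Representation.char_orthonormal ρ τ
    by_cases hne : Nonempty (Representation.Equiv τ ρ)
    · obtain ⟨φ⟩ := hne
      have : ρ.character = τ.character := (Representation.char_iso φ).symm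
      simp only [this, if_true]
      rw [this, if_pos ⟨φ⟩] at h
      exact h
    · rw [if_neg hne] at h
      have hchar : ρ.character ≠ τ.character := by
        intro heq
        have h' := Representation.char_orthonormal τ τ
        rw [if_pos ⟨Representation.Equiv.refl τ⟩, ← heq] at h'
        rw [← heq, h'] at h
        exact one_ne_zero h
      rw [if_neg fun hc => hchar (congrArg Subtype.val hc)]
      exact h
  rw [linearIndependent_iff']
  intro s a hs ψ hψ
  have h1 : ∑ χ ∈ s, a χ * ((Nat.card G : ℂ)⁻¹ * ∑ g : G, χ.1 g * ψ.1 g⁻¹) = 0 := by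
    have : ∑ χ ∈ s, a χ * ((Nat.card G : ℂ)⁻¹ * ∑ g : G, χ.1 g * ψ.1 g⁻¹) =
        (Nat.card G : ℂ)⁻¹ * ∑ g : G, (∑ χ ∈ s, a χ • χ.1) g * ψ.1 g⁻¹ := by
      simp only [Finset.mul_sum, Finset.sum_apply, Finset.sum_mul, Pi.smul_apply, smul_eq_mul]
      rw [Finset.sum_comm]
      refine Finset.sum_congr rfl fun g _ => Finset.sum_congr rfl fun χ _ => by ring
    rw [this, hs]
    simp
  simpa only [horth, mul_ite, mul_one, mul_zero, Finset.sum_ite_eq', hψ, if_true] using h1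

theorem isIrreducible_ofModule' {G k S : Type*} [Group G] [Field k] [AddCommGroup S] [Module k S]
    [Module (MonoidAlgebra k G) S] [IsScalarTower k (MonoidAlgebra k G) S]
    (hS : IsSimpleModule (MonoidAlgebra k G) S) :
    (Representation.ofModule' S : Representation k G S).IsIrreducible := by
  have hnt : Nontrivial S := IsSimpleModule.nontrivial (MonoidAlgebra k G) S
  obtain ⟨v, hv⟩ := exists_ne (0 : S)
  refine { exists_pair_ne := ⟨⊥, ⊤, fun hbt => ?_⟩, eq_bot_or_eq_top := fun p => ?_ }
  · have h1 : v ∈ (⊥ : Subrepresentation (Representation.ofModule' S : Representation k G S)) := by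
      rw [hbt]
      exact Submodule.mem_top (R := k)
    exact hv ((Submodule.mem_bot k).1 h1)
  · let q : Submodule (MonoidAlgebra k G) S :=
      { p.toSubmodule with
        smul_mem' := fun x v hv => by
          induction x using MonoidAlgebra.induction_linear with
          | zero => rw [zero_smul]; exact p.toSubmodule.zero_mem
          | add x y hx hy => rw [add_smul]; exact p.toSubmodule.add_mem hx hy
          | single g a =>
            rw [← mul_one a, ← smul_eq_mul, ← MonoidAlgebra.smul_single, smul_assoc]
            exact p.toSubmodule.smul_mem a (p.apply_mem_toSubmodule g hv) }
    rcases eq_bot_or_eq_top q with hq | hq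
    · left
      refine SetLike.ext fun w => ?_
      change w ∈ q ↔ w ∈ (⊥ : Submodule k S)
      rw [hq, Submodule.mem_bot, Submodule.mem_bot]
    · right
      refine SetLike.ext fun w => ?_
      change w ∈ q ↔ w ∈ (⊤ : Submodule k S)
      simp [hq]

/-- A class function orthogonal to all irreducible characters vanishes. -/
theorem classFunction_eq_zero {G : Type*} [Group G] [Fintype G] (f : G → ℂ)
    (hf : ∀ g h, f (h * g * h⁻¹) = f g) (horth : ∀ χ ∈ Irr G, ∑ g, f g * χ g = 0) : f = 0 := by
  classical
  have : NeZero (Nat.card G : ℂ) := ⟨by exact_mod_cast Nat.card_pos.ne'⟩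
  let A : MonoidAlgebra ℂ G := ∑ g, MonoidAlgebra.single g (f g)
  have hcomm : ∀ x : MonoidAlgebra ℂ G, A * x = x * A := by
    intro x
    induction x using MonoidAlgebra.induction_linear with
    | zero => simp
    | add x y hx hy => rw [mul_add, add_mul, hx, hy]
    | single h c =>
      simp only [A, Finset.sum_mul, Finset.mul_sum, MonoidAlgebra.single_mul_single]
      refine Fintype.sum_equiv (MulAut.conj h⁻¹).toEquiv _ _ fun g => ?_
      have : f (h⁻¹ * (g * h)) = f g := by simpa [mul_assoc] using hf g h⁻¹
      simp [this, mul_comm, mul_assoc]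
  -- By Schur, the central element `A` acts on `S` as a scalar `c`; its trace `c * dim S` is the sum
  -- of `f g * χ g`, which is zero.
  have hA : ∀ S : Submodule (MonoidAlgebra ℂ G) (MonoidAlgebra ℂ G), IsSimpleModule (MonoidAlgebra ℂ G) S → ∀ s ∈ S, A * s = 0 := by
    intro S hS s hs
    let F : Module.End (MonoidAlgebra ℂ G) S :=
      { toFun := fun v => A • v
        map_add' := fun v w => smul_add _ _ _
        map_smul' := fun r v => by
          simp only [RingHom.id_apply, ← mul_smul, hcomm] }
    have : FiniteDimensional ℂ S :=
      FiniteDimensional.of_injective (S.subtype.restrictScalars ℂ) Subtype.val_injective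
    obtain ⟨c, hc⟩ := (IsSimpleModule.algebraMap_end_bijective_of_isAlgClosed (A := MonoidAlgebra ℂ G) (V := S)
      ℂ).2 F
    let ρ : Representation ℂ G S := Representation.ofModule' S
    have hρg : ∀ g (v : S), ρ g v = (MonoidAlgebra.single g (1 : ℂ) : MonoidAlgebra ℂ G) • v := fun g v => rfl
    have hρ : ρ.IsIrreducible := isIrreducible_ofModule' hS
    have hsum : ∑ g, f g • ρ g = c • (1 : Module.End ℂ S) := by
      ext1 v
      have h1 : A • v = c • v := by
        have := LinearMap.congr_fun hc v
        exact this.symm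
      simp only [LinearMap.sum_apply, LinearMap.smul_apply, hρg, Module.End.one_apply]
      rw [← h1]
      simp only [A, Finset.sum_smul]
      refine Finset.sum_congr rfl fun g _ => ?_
      rw [← smul_assoc]
      simp
    have htr := congrArg (LinearMap.trace ℂ S) hsum
    simp only [map_sum, map_smul, LinearMap.trace_one, smul_eq_mul] at htr
    have h0 := horth _ (character_mem_Irr ρ hρ)
    simp only [Representation.character] at h0
    rw [h0] at htr
    have : Nontrivial S := IsSimpleModule.nontrivial (MonoidAlgebra ℂ G) S
    have hc0 : c = 0 := by
      rcases mul_eq_zero.1 htr.symm with h | h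
      · exact h
      · exact absurd h (by exact_mod_cast (Module.finrank_pos (R := ℂ) (M := S)).ne')
    have := LinearMap.congr_fun hc ⟨s, hs⟩
    rw [hc0, map_zero] at this
    exact (congrArg Subtype.val this).symm
  let K : Submodule (MonoidAlgebra ℂ G) (MonoidAlgebra ℂ G) := LinearMap.ker
    ({ toFun := fun v => A * v
       map_add' := fun v w => mul_add _ _ _
       map_smul' := fun r v => by
         simp only [RingHom.id_apply, smul_eq_mul, ← mul_assoc, hcomm] } : 
      MonoidAlgebra ℂ G →ₗ[MonoidAlgebra ℂ G] MonoidAlgebra ℂ G)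
  -- The group algebra is semisimple, hence the sum of its simple submodules, all killed by `A`.
  have hK : K = ⊤ := by
    rw [eq_top_iff, ← IsSemisimpleModule.sSup_simples_eq_top (MonoidAlgebra ℂ G) (MonoidAlgebra ℂ G)]
    exact sSup_le fun S hS s hs => hA S hS s hs
  have h1 : (1 : MonoidAlgebra ℂ G) ∈ K := by rw [hK]; trivial
  have h2 : A = 0 := by
    have : A * 1 = 0 := h1
    rwa [mul_one] at this
  ext g
  have := congrArg (fun x : MonoidAlgebra ℂ G => x.coeff g) h2
  simpa [A, MonoidAlgebra.coeff_sum, MonoidAlgebra.coeff_single, Finsupp.finsetSum_apply,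
    Finsupp.single_apply] using this

/-! ### The character table -/

/-- The character table of `G`. -/
noncomputable def charTable (G : Type*) [Group G] (χ : Irr G) (c : ConjClasses G) : ℂ :=
  Quotient.lift χ.1 (fun _ _ h => Irr_conj χ.2 h) c

theorem charTable_mk {G : Type*} [Group G] (χ : Irr G) (g : G) :
    charTable G χ (ConjClasses.mk g) = χ.1 g :=
  rfl

theorem linearIndependent_charTable (G : Type*) [Group G] [Finite G] :
    LinearIndependent ℂ (charTable G) :=
  LinearIndependent.of_comp (LinearMap.funLeft ℂ ℂ (ConjClasses.mk : G → ConjClasses G))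
    (linearIndependent_Irr G)

/-- A functional vanishing on all rows yields a class function orthogonal to every irreducible
character, hence zero. -/
theorem span_charTable (G : Type*) [Group G] [Finite G] :
    Submodule.span ℂ (Set.range (charTable G)) = ⊤ := by
  classical
  have := Fintype.ofFinite G
  have := Fintype.ofFinite (ConjClasses G)
  by_contra hne
  obtain ⟨φ, hφ0, hφ⟩ := Submodule.exists_le_ker_of_lt_top _ (lt_top_iff_ne_top.2 hne)
  let w : ConjClasses G → ℂ := fun c => (Finset.univ.filter fun g => ConjClasses.mk g = c).card
  have hw : ∀ c, w c ≠ 0 := by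
    intro c
    obtain ⟨g, rfl⟩ := ConjClasses.mk_surjective c
    exact Nat.cast_ne_zero.2 (Finset.card_ne_zero_of_mem (a := g) (by simp))
  -- Dividing by the class size turns a sum over classes into a sum over `G`.
  let a : ConjClasses G → ℂ := fun c => φ (Pi.single c 1) / w c
  have hsum : ∀ F : ConjClasses G → ℂ,
      ∑ g : G, a (ConjClasses.mk g) * F (ConjClasses.mk g) = φ F := by
    intro F
    rw [← Finset.sum_fiberwise Finset.univ (ConjClasses.mk : G → ConjClasses G)]
    conv_rhs => rw [LinearMap.pi_apply_eq_sum_univ φ F]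
    refine Finset.sum_congr rfl fun c _ => ?_
    rw [Finset.sum_congr rfl (g := fun _ => a c * F c)
      fun g hg => by rw [(Finset.mem_filter.1 hg).2]]
    have hsingle : (fun j => if c = j then (1 : ℂ) else 0) = Pi.single c 1 := by
      ext j
      simp [Pi.single_apply, eq_comm]
    rw [Finset.sum_const, ← Nat.cast_smul_eq_nsmul ℂ, smul_eq_mul, smul_eq_mul]
    change w c * (φ (Pi.single c 1) / w c * F c) = _
    rw [hsingle]
    field_simp [hw c]
  have hzero := classFunction_eq_zero (fun g => a (ConjClasses.mk g))
    (fun g h => congrArg a (ConjClasses.mk_eq_mk_iff_isConj.2 (isConj_iff.2 ⟨h, rfl⟩).symm))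
    (fun χ hχ => (hsum (charTable G ⟨χ, hχ⟩)).trans
      (hφ (Submodule.subset_span ⟨⟨χ, hχ⟩, rfl⟩)))
  refine hφ0 (LinearMap.ext fun F => ?_)
  rw [← hsum F]
  refine Finset.sum_eq_zero fun g _ => ?_
  have h := congrFun hzero g
  rw [Pi.zero_apply] at h
  rw [h, zero_mul]

/-- The irreducible characters form a basis of the space of class functions. -/
noncomputable def charTableBasis (G : Type*) [Group G] [Finite G] :
    Module.Basis (Irr G) ℂ (ConjClasses G → ℂ) :=
  Module.Basis.mk (linearIndependent_charTable G) (span_charTable G).ge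

theorem charTableBasis_apply (G : Type*) [Group G] [Finite G] (χ : Irr G) :
    charTableBasis G χ = charTable G χ :=
  Module.Basis.mk_apply _ _ χ

theorem finite_Irr (G : Type*) [Group G] [Finite G] : Finite (Irr G) :=
  Module.Finite.finite_basis (charTableBasis G)

theorem charField_eq {G : Type*} [Group G] (χ : Irr G) :
    charField χ.1 = IntermediateField.adjoin ℚ (Set.range (charTable G χ)) := by
  rw [charField]
  congr 1
  ext z
  constructor
  · rintro ⟨g, rfl⟩
    exact ⟨ConjClasses.mk g, rfl⟩
  · rintro ⟨c, rfl⟩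
    obtain ⟨g, rfl⟩ := ConjClasses.mk_surjective c
    exact ⟨g, rfl⟩

theorem elementField_eq {G : Type*} [Group G] (g : G) :
    elementField g =
      IntermediateField.adjoin ℚ (Set.range fun χ => charTable G χ (ConjClasses.mk g)) := by
  rw [elementField]
  congr 1
  ext z
  constructor
  · rintro ⟨χ, hχ, rfl⟩
    exact ⟨⟨χ, hχ⟩, rfl⟩
  · rintro ⟨χ, rfl⟩
    exact ⟨χ.1, χ.2, rfl⟩

theorem irrationalChars_eq (G : Type*) [Group G] : irrationalChars G = Subtype.val ''
    {χ : Irr G | IntermediateField.adjoin ℚ (Set.range (charTable G χ)) ≠ ⊥} := by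
  ext χ
  constructor
  · rintro ⟨hχ, h⟩
    exact ⟨⟨χ, hχ⟩, fun h' => h ((charField_eq ⟨χ, hχ⟩).trans h'), rfl⟩
  · rintro ⟨χ, h, rfl⟩
    exact ⟨χ.2, (charField_eq χ).symm ▸ h⟩

theorem irrationalClasses_eq (G : Type*) [Group G] : irrationalClasses G =
    {c | IntermediateField.adjoin ℚ (Set.range fun χ => charTable G χ c) ≠ ⊥} := by
  ext c
  constructor
  · rintro ⟨g, rfl, h⟩
    exact fun h' => h ((elementField_eq g).trans h')
  · intro h
    obtain ⟨g, rfl⟩ := ConjClasses.mk_surjective c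
    exact ⟨g, rfl, (elementField_eq g).symm ▸ h⟩

theorem charTable_galois_row {G : Type*} [Group G] (σ : ℂ ≃+* ℂ) (χ : Irr G) :
    ∃ ψ : Irr G, ∀ c, σ (charTable G χ c) = charTable G ψ c := by
  refine ⟨⟨_, galois_mem_Irr σ χ.2⟩, fun c => ?_⟩
  obtain ⟨g, rfl⟩ := ConjClasses.mk_surjective c
  rfl

theorem charTable_galois_column {G : Type*} [Group G] [Finite G] (σ : ℂ ≃+* ℂ)
    (c : ConjClasses G) : ∃ c', ∀ χ : Irr G, σ (charTable G χ c) = charTable G χ c' := by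
  obtain ⟨g, rfl⟩ := ConjClasses.mk_surjective c
  obtain ⟨h, hh⟩ := exists_galois_eq_pow σ g
  exact ⟨ConjClasses.mk h, fun χ => hh χ.1 χ.2⟩

theorem isAlgebraic_charTable {G : Type*} [Group G] [Finite G] (χ : Irr G) (c : ConjClasses G) :
    IsAlgebraic ℚ (charTable G χ c) := by
  obtain ⟨g, rfl⟩ := ConjClasses.mk_surjective c
  exact isAlgebraic_of_mem_Irr χ.2 g

theorem charTable_moved {G : Type*} [Group G] [Finite G] (σ : ℂ ≃+* ℂ) :
    {χ : Irr G | ∃ c, σ (charTable G χ c) ≠ charTable G χ c}.ncard =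
      {c | ∃ χ : Irr G, σ (charTable G χ c) ≠ charTable G χ c}.ncard := by
  have := finite_Irr G
  have h := moved_rows_eq_moved_columns (charTableBasis G) σ
  simp only [charTableBasis_apply] at h
  exact h (charTable_galois_row σ) (charTable_galois_column σ)

end FewIrrational

theorem theoremC :
    ∃ f : ℕ → ℕ, ∀ (n : ℕ) (G : Type*) [Group G] [Finite G],
      ((FewIrrational.irrationalClasses G).encard = (n : ℕ∞) →
        (FewIrrational.irrationalChars G).encard ≤ (f n : ℕ∞) ∧
        ∀ χ ∈ FewIrrational.Irr G,
          Module.rank ℚ (FewIrrational.charField χ) ≤ (f n : Cardinal)) ∧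
      ((FewIrrational.irrationalChars G).encard = (n : ℕ∞) →
        (FewIrrational.irrationalClasses G).encard ≤ (f n : ℕ∞) ∧
        ∀ x : G,
          Module.rank ℚ (FewIrrational.elementField x) ≤ (f n : Cardinal)) := by
  refine ⟨fun n => (n + 1) * n ^ n, fun n G _ _ => ?_⟩
  have := FewIrrational.finite_Irr G
  rw [FewIrrational.irrationalChars_eq, FewIrrational.irrationalClasses_eq,
    Subtype.val_injective.encard_image, ← Set.Finite.cast_ncard_eq (Set.toFinite _),
    ← Set.Finite.cast_ncard_eq (Set.toFinite _), Nat.cast_inj, Nat.cast_inj, Nat.cast_le,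
    Nat.cast_le]
  constructor
  · intro hn
    obtain ⟨h1, h2⟩ := FewIrrational.rows_bounded_of_columns (FewIrrational.charTable G)
      FewIrrational.isAlgebraic_charTable FewIrrational.charTable_galois_column
      FewIrrational.charTable_moved hn
    refine ⟨h1, fun χ hχ => ?_⟩
    rw [FewIrrational.charField_eq ⟨χ, hχ⟩]
    exact h2 ⟨χ, hχ⟩
  · intro hn
    obtain ⟨h1, h2⟩ := FewIrrational.rows_bounded_of_columns
      (fun c χ => FewIrrational.charTable G χ c)
      (fun c χ => FewIrrational.isAlgebraic_charTable χ c) FewIrrational.charTable_galois_row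
      (fun σ => (FewIrrational.charTable_moved σ).symm) hn
    refine ⟨h1, fun x => ?_⟩
    rw [FewIrrational.elementField_eq]
    exact h2 (ConjClasses.mk x)
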